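/- An instance of MinECC consists of a finite node set $V$, a finite set (or family; parallel edges are allowed) $E$ of edges, each edge $e$ being a set of nodes, a color set $[k]=\{1,\dots,k\}$ with $k\ge 1$, a color $\ell(e)\in[k]$ and a weight $w_e\ge 0$ for every $e\in E$. A node coloring $Y:V\to[k]$ makes a mistake at $e$ if $Y(v)\neq \ell(e)$ for some $v\in e$; $\mathcal M_Y$ is the set of edges at which $Y$ makes a mistake, $\mathrm{cost}(Y)=\sum_{e\in\mathcal M_Y} w_e$, and MinECC asks for $\min_Y \mathrm{cost}(Y)$. The canonical LP relaxation is $$\min \sum_{e\in E} w_e x_e\quad\text{s.t.}\quad \sum_{i=1}^k x_v^i=k-1\ (v\in V),\quad x_e\ge x_v^{\ell(e)}\ (v\in e\in E),\quad 0\le x_v^i\le 1,\quad 0\le x_e\le 1 .$$ For an interval $I\subseteq[0,1]$, the algorithm $\mathrm{GenColorRound}(H,I)$ computes an optimal solution $x$ of this LP, draws a threshold $\rho$ uniformly from $I$ and, independently, a uniformly random permutation $\pi$ of $[k]$, and for $i=1,\dots,k$ in this order (re)colors every node $v$ with $x_v^{\pi(i)}<\rho$ by the color $\pi(i)$; nodes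 that are never colored in this loop get arbitrary colors. The output is the resulting coloring $Y$. **Theorem.** Suppose every edge has at most two nodes (the graph case, $r=2$). Then the LP has an optimal solution and, for every optimal solution $x$ used by the algorithm and every way of choosing the arbitrary colors (possibly at random and depending on $\rho$ and $\pi$), the output $Y$ of $\mathrm{GenColorRound}(H,I)$ with $I=(\tfrac12,\tfrac78)$ satisfies $$\mathbb E[\mathrm{cost}(Y)]\ \le\ \tfrac43\sum_{e\in E} w_e x_e \qquad\text{and hence}\qquad \mathbb E[\mathrm{cost}(Y)]\ \le\ \tfrac43\,\min_{Y'}\mathrm{cost}(Y').$$ That is, the algorithm is a $\tfrac43$-approximation for MinECC on graphs, in expectation, relative to the canonical LP value. -/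

import Mathlib

open MeasureTheory ProbabilityTheory

/-- An instance of MinECC: a finite weighted hypergraph with node set `V`, edges indexed by `E`,
and edge colors in the `k`-element set `Fin k`. Indexing the edges by a type allows parallel edges
(possibly of different colors). -/
structure EdgeColoredHypergraph (V E : Type*) (k : ℕ) where
  /-- the set of nodes of an edge -/
  nodes : E → Finset V
  /-- the color `ℓ(e)` of an edge -/
  color : E → Fin k
  /-- the weight `w_e` of an edge -/
  weight : E → ℝ
  weight_nonneg : ∀ e, 0 ≤ weight e

/-- Colors form a finite discrete space, and so do their permutations. -/
instance instMeasurableSpacePermFin (k : ℕ) : MeasurableSpace (Equiv.Perm (Fin k)) := ⊤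

instance instMeasurableSingletonClassPermFin (k : ℕ) :
    MeasurableSingletonClass (Equiv.Perm (Fin k)) := ⟨fun _ => trivial⟩

namespace EdgeColoredHypergraph

variable {V E : Type*} {k : ℕ}

/-- The rank: the maximum number of nodes in an edge. -/
def rank [Fintype E] (H : EdgeColoredHypergraph V E k) : ℕ :=
  Finset.univ.sup fun e => (H.nodes e).card

/-- The set of edges at which the node coloring `Y` makes a mistake. -/
def mistakes (H : EdgeColoredHypergraph V E k) (Y : V → Fin k) : Set E :=
  {e | ∃ v ∈ H.nodes e, Y v ≠ H.color e}

/-- The MinECC objective of the node coloring `Y`: the total weight of its mistakes. -/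
noncomputable def cost [Fintype E] (H : EdgeColoredHypergraph V E k) (Y : V → Fin k) : ℝ :=
  ∑ e, H.weight e * (H.mistakes Y).indicator 1 e

/-- The optimal value of MinECC. For `k ≥ 1` and finite `V` this is a minimum over a finite
nonempty set of colorings. -/
noncomputable def minECC [Fintype E] (H : EdgeColoredHypergraph V E k) : ℝ :=
  ⨅ Y : V → Fin k, H.cost Y

/-- Feasibility for the canonical LP relaxation; `x v i` is the variable of the node-color pair
`(v, i)` and `y e` is the variable of the edge `e`. -/
structure LPFeasible (H : EdgeColoredHypergraph V E k) (x : V → Fin k → ℝ) (y : E → ℝ) :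
    Prop where
  sum_eq : ∀ v, ∑ i, x v i = (k : ℝ) - 1
  node_le_edge : ∀ e, ∀ v ∈ H.nodes e, x v (H.color e) ≤ y e
  node_mem : ∀ v i, 0 ≤ x v i ∧ x v i ≤ 1
  edge_mem : ∀ e, 0 ≤ y e ∧ y e ≤ 1

/-- The objective of the canonical LP relaxation. -/
noncomputable def lpObjective [Fintype E] (H : EdgeColoredHypergraph V E k) (y : E → ℝ) : ℝ :=
  ∑ e, H.weight e * y e

/-- `(x, y)` is an optimal solution of the canonical LP relaxation. -/
def LPOptimal [Fintype E] (H : EdgeColoredHypergraph V E k) (x : V → Fin k → ℝ) (y : E → ℝ) :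
    Prop :=
  H.LPFeasible x y ∧ ∀ x' y', H.LPFeasible x' y' → H.lpObjective y ≤ H.lpObjective y'

end EdgeColoredHypergraph

/-- The rounding loop, for node-color variables `x`, threshold `ρ` and permutation `π`:
for `i = 1, …, k` in this order, every node `v` with `x v (π i) < ρ` is (re)colored with `π i`.
A node `v` that no color wants keeps the arbitrary color `d v`. -/
noncomputable def genColorRound {V : Type*} {k : ℕ} (x : V → Fin k → ℝ) (ρ : ℝ)
    (π : Equiv.Perm (Fin k)) (d : V → Fin k) : V → Fin k :=
  (List.finRange k).foldl (fun Y i v => if x v (π i) < ρ then π i else Y v) d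

/-- The law of the random choices of the algorithm: a threshold `ρ` uniform in `I` and,
independently, a uniform permutation `π` of the colors. -/
noncomputable def roundingLaw (k : ℕ) (I : Set ℝ) : Measure (ℝ × Equiv.Perm (Fin k)) :=
  (cond (volume : Measure ℝ) I).prod (uniformOn Set.univ)

/-! Fix an edge with endpoints `u`, `v` and color `c`, and let `z` be the larger of its two node
variables at `c`. By linearity and `z ≤ y e`, it suffices that a mistake has probability at most
`4/3 * z`. Whatever the arbitrary colors are, there is no mistake if `ρ > z` and `c` comes last in
`π` among the colors wanted by `u` or `v`. With `n` other wanted colors, a threshold `ρ > z` thus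
fails with probability at most `n / (n + 1)`. This is concave in `n`, so at integers `n ≥ 1` it lies
below a suitable line `α + β * n`. As `n` is at most the sum of the counts at `u` and `v`,
integrating over `ρ` leaves only the lengths of the threshold ranges in which single colors compete.

The LP controls these lengths. At a node `w` the complements `1 - x w i` sum to `1`, so those of the
competitors `i ≠ c` sum to `x w c ≤ z`. Hence no competitor is wanted before `ρ > 1 - z`. Since `ρ <
7/8`, a competitor matters only for the part of its complement above `1/8`, and two that matter at
one node lose at least `1/4` of the budget `z` (`sum_threshold_lengths_le`). What remains is an
inequality in `z` alone, `exists_affine_bound_threshold`. -/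

/-! ### Numerical estimates for threshold lengths -/

/-- Only terms with `b i > δ` contribute. A single one is capped by `τ - δ`; two or more share the
budget `z` and each pays `δ`. -/
theorem sum_truncated_excess_le {ι : Type*} (s : Finset ι) (b : ι → ℝ) {τ δ z : ℝ} (hδ : 0 ≤ δ)
    (hb : ∀ i ∈ s, 0 ≤ b i) (hsum : ∑ i ∈ s, b i ≤ z) :
    ∑ i ∈ s, max (min τ (b i) - δ) 0 ≤ max (max (τ - δ) (z - 2 * δ)) 0 := by
  classical
  set J := s.filter fun i => δ < b i with hJ
  have h1 : ∑ i ∈ s, max (min τ (b i) - δ) 0 = ∑ i ∈ J, max (min τ (b i) - δ) 0 := by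
    rw [hJ, Finset.sum_filter_of_ne]
    intro i _ hne
    by_contra hle
    refine hne (max_eq_right ?_)
    linarith [min_le_right τ (b i)]
  rw [h1]
  rcases Nat.lt_or_ge 1 J.card with h2 | h2
  · have h3 : ∑ i ∈ J, max (min τ (b i) - δ) 0 ≤ ∑ i ∈ J, (b i - δ) := by
      refine Finset.sum_le_sum fun i hi => max_le ?_ ?_
      · linarith [min_le_right τ (b i)]
      · linarith [(Finset.mem_filter.1 hi).2]
    have h4 : ∑ i ∈ J, b i ≤ z :=
      (Finset.sum_le_sum_of_subset_of_nonneg (Finset.filter_subset _ _)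
        fun i hi _ => hb i hi).trans hsum
    rw [Finset.sum_sub_distrib, Finset.sum_const, nsmul_eq_mul] at h3
    have h5 : (2 : ℝ) ≤ J.card := by exact_mod_cast h2
    refine le_max_of_le_left (le_max_of_le_right ?_)
    nlinarith
  · have h3 : ∑ i ∈ J, max (min τ (b i) - δ) 0 ≤ J.card • max (τ - δ) 0 := by
      refine Finset.sum_le_card_nsmul _ _ _ fun i _ => max_le_max ?_ le_rfl
      linarith [min_le_left τ (b i)]
    have h4 : J.card • max (τ - δ) 0 ≤ max (τ - δ) 0 := by
      rw [nsmul_eq_mul]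
      have : (J.card : ℝ) ≤ 1 := by exact_mod_cast h2
      nlinarith [le_max_right (τ - δ) 0]
    exact (h3.trans h4).trans (max_le_max (le_max_left _ _) le_rfl)

/-- The total length of the parts of `(1/2, 7/8)` in which the thresholds exceed both `z` and
`a i`, when the complements `1 - a i` sum to at most `z`. -/
theorem sum_threshold_lengths_le {ι : Type*} (s : Finset ι) (a : ι → ℝ) {z : ℝ}
    (ha : ∀ i ∈ s, a i ≤ 1) (hsum : ∑ i ∈ s, (1 - a i) ≤ z) :
    ∑ i ∈ s, max (7 / 8 - max (max z (a i)) (1 / 2)) 0 ≤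
      max (max (7 / 8 - max z (1 - z)) (z - 1 / 4)) 0 := by
  have hb : ∀ i ∈ s, 0 ≤ 1 - a i := fun i hi => by linarith [ha i hi]
  -- Here `δ = 1 - 7/8`, and the cap `τ = min z (1 - z)` encodes both `1 - a i ≤ z` and the
  -- requirement that the threshold exceed `z`.
  refine le_trans (Finset.sum_le_sum fun i hi => ?_)
    ((sum_truncated_excess_le (τ := 1 - max z (1 - z)) (δ := 1 / 8) s _ (by norm_num) hb
      hsum).trans (le_of_eq ?_))
  · have h1 : 1 - a i ≤ z := (Finset.single_le_sum hb hi).trans hsum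
    refine max_le_max ?_ le_rfl
    rcases le_total z (1 - z) with h | h <;>
      simp only [h, max_eq_left, max_eq_right] <;>
      rcases le_total z (a i) with h2 | h2 <;>
      simp only [h2, max_eq_left, max_eq_right] <;>
      (first
        | (have := le_max_left (a i) (1/2 : ℝ)
           have := le_max_right (a i) (1/2 : ℝ)
           rcases min_choice (1 - (1 - z)) (1 - a i) with h3 | h3 <;> rw [h3] <;> linarith)
        | (have := le_max_left (a i) (1/2 : ℝ)
           have := le_max_right (a i) (1/2 : ℝ)
           rcases min_choice (1 - z) (1 - a i) with h3 | h3 <;> rw [h3] <;> linarith)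
        | (have := le_max_left z (1/2 : ℝ)
           have := le_max_right z (1/2 : ℝ)
           rcases min_choice (1 - (1 - z)) (1 - a i) with h3 | h3 <;> rw [h3] <;> linarith)
        | (have := le_max_left z (1/2 : ℝ)
           have := le_max_right z (1/2 : ℝ)
           rcases min_choice (1 - z) (1 - a i) with h3 | h3 <;> rw [h3] <;> linarith))
  · congr 2 <;> ring

/-- All terms are lengths inside an interval of length `3/8`; multiplying by `8/3` turns `z / 2`
into `4/3 * z`. `M` is the total competing length at both endpoints. -/
theorem exists_affine_bound_threshold {z : ℝ} (hz : 0 ≤ z) :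
    ∃ α β : ℝ, 0 ≤ β ∧ (∀ n : ℕ, 1 ≤ n → (n : ℝ) / (n + 1) ≤ α + β * n) ∧ 0 ≤ α ∧
      ∀ M : ℝ, M ≤ 2 * max (max (7 / 8 - max z (1 - z)) (z - 1 / 4)) 0 →
        3 / 8 - max (7 / 8 - max z (1 / 2)) 0 + α * max (7 / 8 - max (max z (1 - z)) (1 / 2)) 0
          + β * M ≤ z / 2 := by
  rcases le_total z (5 / 8) with h | h
  · refine ⟨1 / 2, 1 / 12, by norm_num, fun n hn => ?_, by norm_num, fun M hM => ?_⟩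
    · rw [div_le_iff₀ (by positivity)]
      have h0 : (0 : ℝ) ≤ ((n : ℝ) - 2) * (n - 3) := by
        rcases Nat.lt_or_ge n 3 with h3 | h3
        · have h3 : (n : ℝ) ≤ 2 := by exact_mod_cast (Nat.lt_succ_iff.1 h3)
          nlinarith
        · have h3 : (3 : ℝ) ≤ n := by exact_mod_cast h3
          nlinarith
      nlinarith
    · rcases le_total z (1 / 2) with h1 | h1
      · rw [max_eq_right (show z ≤ 1 - z by linarith)] at *
        rw [max_eq_right h1, max_eq_left (show 1 / 2 ≤ 1 - z by linarith)]
        rcases le_total z (1 / 8) with h2 | h2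
        · rw [max_eq_right (max_le (by linarith) (by linarith) :
            max (7 / 8 - (1 - z)) (z - 1 / 4) ≤ 0)] at hM
          rw [max_eq_right (by linarith : 7 / 8 - (1 - z) ≤ 0)]
          norm_num
          linarith
        · rw [max_eq_left (show (0:ℝ) ≤ 7 / 8 - (1 - z) by linarith)]
          rw [max_eq_left (show z - 1 / 4 ≤ 7 / 8 - (1 - z) by linarith),
            max_eq_left (show (0:ℝ) ≤ 7 / 8 - (1 - z) by linarith)] at hM
          norm_num
          linarith
      · rw [max_eq_left (show 1 - z ≤ z by linarith)] at *
        rw [max_eq_left h1, max_eq_left (show 0 ≤ 7 / 8 - z by linarith)]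
        have : max (max (7 / 8 - z) (z - 1 / 4)) 0 ≤ 3 / 8 :=
          max_le (max_le (by linarith) (by linarith)) (by norm_num)
        linarith
  · refine ⟨3 / 5, 1 / 20, by norm_num, fun n hn => ?_, by norm_num, fun M hM => ?_⟩
    · rw [div_le_iff₀ (by positivity)]
      have h0 : (0 : ℝ) ≤ ((n : ℝ) - 3) * (n - 4) := by
        rcases Nat.lt_or_ge n 4 with h3 | h3
        · have h3 : (n : ℝ) ≤ 3 := by exact_mod_cast (Nat.lt_succ_iff.1 h3)
          nlinarith
        · have h3 : (4 : ℝ) ≤ n := by exact_mod_cast h3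
          nlinarith
      nlinarith
    · rw [max_eq_left (show 1 - z ≤ z by linarith)] at *
      rw [max_eq_left (show 1 / 2 ≤ z by linarith)]
      have : max (max (7 / 8 - z) (z - 1 / 4)) 0 ≤ z - 1 / 4 :=
        max_le (max_le (by linarith) le_rfl) (by linarith)
      rcases le_total z (7 / 8) with h2 | h2
      · rw [max_eq_left (show 0 ≤ 7 / 8 - z by linarith)]
        linarith
      · rw [max_eq_right (show 7 / 8 - z ≤ 0 by linarith)]
        linarith

/-! ### The last wanted color in a random order -/

/-- Some element of `insert c S` comes last in every order, and exchanging the names `s` and `c`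
injects the orders with `s` last into those with `c` last. -/
theorem factorial_le_card_perm_last {k : ℕ} (S : Finset (Fin k)) (c : Fin k) (hc : c ∉ S) :
    k.factorial ≤ (S.card + 1) *
      (Finset.univ.filter fun p : Equiv.Perm (Fin k) => ∀ j ∈ S, p.symm j < p.symm c).card := by
  classical
  set A : Fin k → Finset (Equiv.Perm (Fin k)) := fun s =>
    Finset.univ.filter fun p => ∀ j ∈ insert c S, j ≠ s → p.symm j < p.symm s with hA
  have hAc : A c = Finset.univ.filter fun p : Equiv.Perm (Fin k) =>
      ∀ j ∈ S, p.symm j < p.symm c := by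
    ext p
    simp only [hA, Finset.mem_filter, Finset.mem_univ, true_and, Finset.mem_insert]
    constructor
    · exact fun h j hj => h j (Or.inr hj) (by rintro rfl; exact hc hj)
    · rintro h j (rfl | hj) hne
      · exact absurd rfl hne
      · exact h j hj
  have hcard : ∀ s ∈ insert c S, (A s).card ≤ (A c).card := by
    intro s hs
    refine Finset.card_le_card_of_injOn (fun p => p.trans (Equiv.swap s c)) ?_
      (fun p _ q _ h => Equiv.ext fun i => (Equiv.swap s c).injective (Equiv.congr_fun h i))
    intro p hp
    simp only [hA, Finset.coe_filter, Finset.mem_univ, true_and, Set.mem_ofPred_eq,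
      Equiv.symm_trans_apply, Equiv.symm_swap, Equiv.swap_apply_right] at hp ⊢
    intro j hj hne
    refine hp _ ?_ ?_
    · rcases eq_or_ne j s with rfl | h
      · simp
      · rwa [Equiv.swap_apply_of_ne_of_ne h hne]
    · intro h
      apply hne
      exact (Equiv.swap s c).injective (h.trans (Equiv.swap_apply_right s c).symm)
  have hcover : (Finset.univ : Finset (Equiv.Perm (Fin k))) ⊆ (insert c S).biUnion A := by
    intro p _
    obtain ⟨s, hs, hmax⟩ := (insert c S).exists_max_image p.symm ⟨c, by simp⟩
    refine Finset.mem_biUnion.2 ⟨s, hs, ?_⟩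
    simp only [hA, Finset.mem_filter, Finset.mem_univ, true_and]
    exact fun j hj hne => lt_of_le_of_ne (hmax j hj) fun h => hne (p.symm.injective h)
  calc k.factorial = (Finset.univ : Finset (Equiv.Perm (Fin k))).card := by
        rw [Finset.card_univ, Fintype.card_perm, Fintype.card_fin]
    _ ≤ ((insert c S).biUnion A).card := Finset.card_le_card hcover
    _ ≤ (insert c S).card * (A c).card := Finset.card_biUnion_le_card_mul _ _ _ hcard
    _ = _ := by rw [Finset.card_insert_of_notMem hc, hAc]

theorem genColorRound_eq_of_last {V : Type*} {k : ℕ} {x : V → Fin k → ℝ} {ρ : ℝ}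
    {π : Equiv.Perm (Fin k)} {d : V → Fin k} {v : V} {c : Fin k} (hc : x v c < ρ)
    (hlast : ∀ j, j ≠ c → x v j < ρ → π.symm j < π.symm c) :
    genColorRound x ρ π d v = c := by
  -- Loop invariant: the turn of `c` is still to come, or `v` already has color `c` and only later
  -- turns remain.
  have key : ∀ (l : List (Fin k)) (Y : V → Fin k), l.Pairwise (· < ·) →
      (π.symm c ∈ l ∨ (Y v = c ∧ ∀ i ∈ l, π.symm c < i)) →
      l.foldl (fun Y i v => if x v (π i) < ρ then π i else Y v) Y v = c := by
    intro l
    induction l with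
    | nil => intro Y _ h; simpa using h
    | cons a l ih =>
      intro Y hl h
      rw [List.pairwise_cons] at hl
      refine ih _ hl.2 ?_
      rcases h with h | ⟨hY, h⟩
      · rcases List.mem_cons.1 h with rfl | h
        · exact Or.inr ⟨by simp [hc], hl.1⟩
        · exact Or.inl h
      · refine Or.inr ⟨?_, fun i hi => h i (List.mem_cons_of_mem _ hi)⟩
        have ha := h a List.mem_cons_self
        refine (if_neg fun hlt => ?_).trans hY
        have hne : π a ≠ c := by rintro rfl; simp at ha
        have := hlast _ hne hlt
        rw [Equiv.symm_apply_apply] at this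
        exact absurd ha this.asymm
  exact key _ _ (List.pairwise_lt_finRange k) (Or.inl (List.mem_finRange _))

/-- The threshold and permutation pairs for which some node in `{u, v}` may fail to receive the
color `c`: it does not want `c`, or some other wanted color comes after `c`. -/
def unsafeChoices {V : Type*} {k : ℕ} (x : V → Fin k → ℝ) (u v : V) (c : Fin k) :
    Set (ℝ × Equiv.Perm (Fin k)) :=
  {q | ¬ (max (x u c) (x v c) < q.1 ∧
    ∀ j, j ≠ c → (x u j < q.1 ∨ x v j < q.1) → q.2.symm j < q.2.symm c)}

/-! ### The mistake probability of one edge -/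

section

variable {V : Type*} {k : ℕ}

theorem measurableSet_unsafeChoices (x : V → Fin k → ℝ) (u v : V) (c : Fin k) :
    MeasurableSet (unsafeChoices x u v c) := by
  have hlt : ∀ a : ℝ, MeasurableSet {q : ℝ × Equiv.Perm (Fin k) | a < q.1} := fun a =>
    measurableSet_lt measurable_const measurable_fst
  have hp : ∀ j, MeasurableSet {q : ℝ × Equiv.Perm (Fin k) | q.2.symm j < q.2.symm c} := fun j =>
    measurable_snd (t := {p : Equiv.Perm (Fin k) | p.symm j < p.symm c}) trivial
  refine ((hlt _).inter ?_).compl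
  refine measurableSet_setOfPred.2 (Measurable.forall fun j => ?_)
  exact measurable_const.imp
    (((measurableSet_setOfPred.1 (hlt _)).or (measurableSet_setOfPred.1 (hlt _))).imp
      (measurableSet_setOfPred.1 (hp j)))

theorem EdgeColoredHypergraph.mem_unsafeChoices_of_mem_mistakes {E : Type*}
    {H : EdgeColoredHypergraph V E k} {x : V → Fin k → ℝ} {ρ : ℝ} {π : Equiv.Perm (Fin k)}
    {d : V → Fin k} {e : E} {u v : V} (hnodes : ∀ w ∈ H.nodes e, w = u ∨ w = v)
    (he : e ∈ H.mistakes (genColorRound x ρ π d)) :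
    (ρ, π) ∈ unsafeChoices x u v (H.color e) := by
  rintro ⟨hlt, hlast⟩
  obtain ⟨w, hw, hne⟩ := he
  refine hne ?_
  rcases hnodes w hw with rfl | rfl
  · exact genColorRound_eq_of_last ((le_max_left _ _).trans_lt hlt)
      fun j hj hjw => hlast j hj (Or.inl hjw)
  · exact genColorRound_eq_of_last ((le_max_right _ _).trans_lt hlt)
      fun j hj hjw => hlast j hj (Or.inr hjw)

instance isProbabilityMeasure_uniformOn_perm :
    IsProbabilityMeasure (uniformOn (Set.univ : Set (Equiv.Perm (Fin k)))) :=
  isProbabilityMeasure_uniformOn Set.finite_univ Set.univ_nonempty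

instance isProbabilityMeasure_cond_Ioo :
    IsProbabilityMeasure (cond (volume : Measure ℝ) (Set.Ioo (1 / 2) (7 / 8))) :=
  cond_isProbabilityMeasure_of_finite (by rw [Real.volume_Ioo]; norm_num)
    (by rw [Real.volume_Ioo]; exact ENNReal.ofReal_ne_top)

instance isProbabilityMeasure_roundingLaw :
    IsProbabilityMeasure (roundingLaw k (Set.Ioo (1 / 2) (7 / 8))) := by
  unfold roundingLaw; infer_instance

theorem cond_Ioo_real_Ioi (a : ℝ) :
    (cond (volume : Measure ℝ) (Set.Ioo (1 / 2) (7 / 8))).real (Set.Ioi a) =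
      8 / 3 * max (7 / 8 - max a (1 / 2)) 0 := by
  have h : Set.Ioo (1 / 2 : ℝ) (7 / 8) ∩ Set.Ioi a = Set.Ioo (max a (1 / 2)) (7 / 8) := by
    ext t; simp only [Set.mem_inter_iff, Set.mem_Ioo, Set.mem_Ioi, max_lt_iff]; tauto
  rw [Measure.real, cond_apply measurableSet_Ioo, h, Real.volume_Ioo, Real.volume_Ioo,
    ENNReal.toReal_mul, ENNReal.toReal_inv, ENNReal.toReal_ofReal (by norm_num), ENNReal.toReal_ofReal']
  norm_num

theorem uniformOn_perm_real_not_last_le (S : Finset (Fin k)) (c : Fin k) (hc : c ∉ S) :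
    (uniformOn (Set.univ : Set (Equiv.Perm (Fin k)))).real
      {p | ¬ ∀ j ∈ S, p.symm j < p.symm c} ≤ (S.card : ℝ) / (S.card + 1) := by
  classical
  set A : Finset (Equiv.Perm (Fin k)) :=
    Finset.univ.filter fun p : Equiv.Perm (Fin k) => ∀ j ∈ S, p.symm j < p.symm c with hA
  have hcard : (k.factorial : ℝ) ≤ (S.card + 1) * A.card := by
    exact_mod_cast factorial_le_card_perm_last S c hc
  have hAr : (uniformOn (Set.univ : Set (Equiv.Perm (Fin k)))).real (A : Set _) =
      A.card / k.factorial := by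
    rw [Measure.real, uniformOn_univ, Measure.count_apply_finset, Fintype.card_perm,
      Fintype.card_fin]
    simp
  have hset : {p : Equiv.Perm (Fin k) | ¬ ∀ j ∈ S, p.symm j < p.symm c} = (A : Set _)ᶜ := by
    ext p; simp [hA]
  rw [hset, probReal_compl_eq_one_sub A.measurableSet, hAr]
  have hk : (0 : ℝ) < k.factorial := by exact_mod_cast k.factorial_pos
  have hS : (0 : ℝ) < S.card + 1 := by positivity
  have : 1 / ((S.card : ℝ) + 1) ≤ A.card / k.factorial := by
    rw [div_le_div_iff₀ hS hk]; linarith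
  have h1 : (S.card : ℝ) / (S.card + 1) = 1 - 1 / (S.card + 1) := by field_simp; ring
  linarith

/-- The bound is a sum of indicators of rays in `r`, so that its integral is a sum of lengths. The
constant `α` is charged only for `r > 1 - z`, because without competitors `c` is last for free. -/
theorem uniformOn_real_unsafeChoices_slice_le {x : V → Fin k → ℝ} {u v : V} {c : Fin k}
    (h0 : ∀ w i, 0 ≤ 1 - x w i) (hs : ∀ w, ∑ i, (1 - x w i) = 1)
    {α β : ℝ} (hα : 0 ≤ α) (hβ : 0 ≤ β)
    (hαβ : ∀ n : ℕ, 1 ≤ n → (n : ℝ) / (n + 1) ≤ α + β * n) (r : ℝ) :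
    (uniformOn (Set.univ : Set (Equiv.Perm (Fin k)))).real
        {p | (r, p) ∈ unsafeChoices x u v c} ≤
      1 - (Set.Ioi (max (x u c) (x v c))).indicator 1 r +
        α * (Set.Ioi (max (max (x u c) (x v c)) (1 - max (x u c) (x v c)))).indicator 1 r +
        β * (∑ i ∈ Finset.univ.erase c, (Set.Ioi (max (max (x u c) (x v c)) (x u i))).indicator 1 r
          + ∑ i ∈ Finset.univ.erase c,
            (Set.Ioi (max (max (x u c) (x v c)) (x v i))).indicator 1 r) := by
  classical
  set z := max (x u c) (x v c) with hz
  have hind : ∀ a : ℝ, (0 : ℝ) ≤ (Set.Ioi a).indicator 1 r := fun a =>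
    Set.indicator_nonneg (fun _ _ => zero_le_one) _
  have hsums : ∀ w, 0 ≤ ∑ i ∈ Finset.univ.erase c,
      (Set.Ioi (max z (x w i))).indicator (1 : ℝ → ℝ) r := fun w =>
    Finset.sum_nonneg fun i _ => hind _
  by_cases hr : z < r
  swap
  · rw [Set.indicator_of_notMem (s := Set.Ioi z) (by simpa using hr)]
    have := mul_nonneg hα (hind (max z (1 - z)))
    have := mul_nonneg hβ (add_nonneg (hsums u) (hsums v))
    have := measureReal_le_one (μ := uniformOn (Set.univ : Set (Equiv.Perm (Fin k))))
      (s := {p | (r, p) ∈ unsafeChoices x u v c})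
    linarith
  rw [Set.indicator_of_mem (s := Set.Ioi z) hr]
  set S : V → Finset (Fin k) := fun w => (Finset.univ.erase c).filter fun j => x w j < r with hS
  have hsumS : ∀ w, ∑ i ∈ Finset.univ.erase c,
      (Set.Ioi (max z (x w i))).indicator (1 : ℝ → ℝ) r = (S w).card := by
    intro w
    rw [hS, Finset.card_filter, Nat.cast_sum]
    refine Finset.sum_congr rfl fun i _ => ?_
    simp [Set.indicator_apply, hr]
  rw [hsumS, hsumS]
  have hslice : {p : Equiv.Perm (Fin k) | (r, p) ∈ unsafeChoices x u v c} =
      {p | ¬ ∀ j ∈ S u ∪ S v, p.symm j < p.symm c} := by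
    ext p
    simp only [unsafeChoices, hS, ← hz, Set.mem_ofPred_eq, hr, true_and, Finset.mem_union,
      Finset.mem_filter, Finset.mem_erase, Finset.mem_univ, and_true, ← and_or_left, and_imp]
  rw [hslice]
  have hcS : c ∉ S u ∪ S v := by simp [hS]
  refine (uniformOn_perm_real_not_last_le _ _ hcS).trans ?_
  have hle : ((S u ∪ S v).card : ℝ) ≤ (S u).card + (S v).card := by
    exact_mod_cast Finset.card_union_le _ _
  rcases Nat.eq_zero_or_pos (S u ∪ S v).card with hn | hn
  · rw [hn]
    have := mul_nonneg hα (hind (max z (1 - z)))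
    have : 0 ≤ β * ((S u).card + (S v).card : ℝ) := by positivity
    simp only [Pi.one_apply, Nat.cast_zero, zero_div]
    linarith
  -- A competitor `j` at `w` has `1 - x w j ≤ x w c ≤ z`, so it is wanted only when `r > 1 - z`.
  · have hrz : 1 - z < r := by
      obtain ⟨j, hj⟩ := Finset.card_pos.1 hn
      have key : ∀ w, x w c ≤ z → j ∈ S w → 1 - z < r := by
        intro w hw hj
        simp only [hS, Finset.mem_filter, Finset.mem_erase, Finset.mem_univ, and_true] at hj
        have h1 : (1 - x w j) + (1 - x w c) ≤ ∑ i, (1 - x w i) := by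
          rw [← Finset.sum_pair hj.1 (f := fun i => 1 - x w i)]
          exact Finset.sum_le_sum_of_subset_of_nonneg (Finset.subset_univ _)
            fun i _ _ => h0 w i
        linarith [hs w, hj.2]
      rcases Finset.mem_union.1 hj with h | h
      · exact key u (le_max_left _ _) h
      · exact key v (le_max_right _ _) h
    rw [Set.indicator_of_mem (s := Set.Ioi (max z (1 - z))) (max_lt hr hrz)]
    have h1 := hαβ _ hn
    have h2 := mul_le_mul_of_nonneg_left hle hβ
    simp only [Pi.one_apply]
    linarith

theorem roundingLaw_real_unsafeChoices_le {x : V → Fin k → ℝ} {u v : V} {c : Fin k}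
    (h0 : ∀ w i, 0 ≤ x w i) (h1 : ∀ w i, x w i ≤ 1) (hs : ∀ w, ∑ i, x w i = (k : ℝ) - 1) :
    (roundingLaw k (Set.Ioo (1 / 2) (7 / 8))).real (unsafeChoices x u v c) ≤
      4 / 3 * max (x u c) (x v c) := by
  classical
  have hs' : ∀ w, ∑ i, (1 - x w i) = 1 := fun w => by
    rw [Finset.sum_sub_distrib, hs]; simp
  set z := max (x u c) (x v c) with hz
  obtain ⟨α, β, hβ, hαβ, hα, hM⟩ :=
    exists_affine_bound_threshold (z := z) ((h0 u c).trans (le_max_left _ _))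
  set μ := cond (volume : Measure ℝ) (Set.Ioo (1 / 2) (7 / 8)) with hμ
  have hprod : (roundingLaw k (Set.Ioo (1 / 2) (7 / 8))).real (unsafeChoices x u v c) =
      ∫ r, (uniformOn (Set.univ : Set (Equiv.Perm (Fin k)))).real
        {p | (r, p) ∈ unsafeChoices x u v c} ∂μ := by
    change _ = ∫ r, (uniformOn (Set.univ : Set (Equiv.Perm (Fin k)))).real
      (Prod.mk r ⁻¹' unsafeChoices x u v c) ∂μ
    rw [roundingLaw, Measure.real, Measure.prod_apply (measurableSet_unsafeChoices x u v c),
      integral_eq_lintegral_of_nonneg_ae (.of_forall fun _ => measureReal_nonneg)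
        ((measurable_measure_prodMk_left
          (measurableSet_unsafeChoices x u v c)).ennreal_toReal.aestronglyMeasurable)]
    congr 1
    refine lintegral_congr fun r => ?_
    rw [ofReal_measureReal]
  have hint : ∀ a : ℝ, Integrable ((Set.Ioi a).indicator (1 : ℝ → ℝ)) μ := fun a =>
    (integrable_const (1 : ℝ)).indicator measurableSet_Ioi
  have hval : ∀ a : ℝ, ∫ r, (Set.Ioi a).indicator (1 : ℝ → ℝ) r ∂μ =
      8 / 3 * max (7 / 8 - max a (1 / 2)) 0 := fun a => by
    rw [integral_indicator_one measurableSet_Ioi, cond_Ioo_real_Ioi]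
  have hintS : ∀ w, Integrable (fun r => ∑ i ∈ Finset.univ.erase c,
      (Set.Ioi (max z (x w i))).indicator (1 : ℝ → ℝ) r) μ := fun w =>
    integrable_finsetSum _ fun i _ => hint _
  have hvalS : ∀ w, ∫ r, ∑ i ∈ Finset.univ.erase c,
      (Set.Ioi (max z (x w i))).indicator (1 : ℝ → ℝ) r ∂μ =
      8 / 3 * ∑ i ∈ Finset.univ.erase c, max (7 / 8 - max (max z (x w i)) (1 / 2)) 0 := fun w => by
    rw [integral_finsetSum _ fun i _ => hint _, Finset.mul_sum]
    exact Finset.sum_congr rfl fun i _ => hval _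
  have hsumle : ∀ w, x w c ≤ z →
      ∑ i ∈ Finset.univ.erase c, max (7 / 8 - max (max z (x w i)) (1 / 2)) 0 ≤
        max (max (7 / 8 - max z (1 - z)) (z - 1 / 4)) 0 := fun w hw => by
    refine sum_threshold_lengths_le _ _ (fun i _ => h1 w i) ?_
    have := Finset.add_sum_erase Finset.univ (fun i => 1 - x w i) (Finset.mem_univ c)
    rw [hs' w] at this
    linarith
  have hbound := hM (∑ i ∈ Finset.univ.erase c, max (7 / 8 - max (max z (x u i)) (1 / 2)) 0 +
      ∑ i ∈ Finset.univ.erase c, max (7 / 8 - max (max z (x v i)) (1 / 2)) 0)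
    (by linarith [hsumle u (le_max_left _ _), hsumle v (le_max_right _ _)])
  rw [hprod]
  have hi1 := (integrable_const (μ := μ) (1 : ℝ)).sub (hint z)
  have hi2 := (hint (max z (1 - z))).const_mul α
  have hi3 := ((hintS u).add (hintS v)).const_mul β
  calc _ ≤ ∫ r, (1 - (Set.Ioi z).indicator (1 : ℝ → ℝ) r +
        α * (Set.Ioi (max z (1 - z))).indicator 1 r +
        β * (∑ i ∈ Finset.univ.erase c, (Set.Ioi (max z (x u i))).indicator 1 r
          + ∑ i ∈ Finset.univ.erase c, (Set.Ioi (max z (x v i))).indicator 1 r)) ∂μ := by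
        refine integral_mono_of_nonneg (.of_forall fun _ => measureReal_nonneg)
          ((hi1.add hi2).add hi3) (.of_forall fun r => ?_)
        exact uniformOn_real_unsafeChoices_slice_le
          (fun w i => by linarith [h1 w i]) hs' hα hβ hαβ r
    _ = 1 - 8 / 3 * max (7 / 8 - max z (1 / 2)) 0 +
        α * (8 / 3 * max (7 / 8 - max (max z (1 - z)) (1 / 2)) 0) +
        β * (8 / 3 * ∑ i ∈ Finset.univ.erase c, max (7 / 8 - max (max z (x u i)) (1 / 2)) 0 +
          8 / 3 * ∑ i ∈ Finset.univ.erase c, max (7 / 8 - max (max z (x v i)) (1 / 2)) 0) := by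
        have e1 := integral_add (hi1.add hi2) hi3
        have e2 := integral_add hi1 hi2
        have e3 := integral_sub (integrable_const (μ := μ) (1 : ℝ)) (hint z)
        have e4 := integral_add (hintS u) (hintS v)
        simp only [Pi.add_apply, Pi.sub_apply] at e1 e2
        rw [e1, e2, e3, integral_const_mul, integral_const_mul]
        rw [e4, hval, hval, hvalS, hvalS]
        simp
    _ ≤ 4 / 3 * z := by linarith

end

/-! ### Measurability, LP solutions and cost -/

theorem measurable_genColorRound_threshold {V : Type*} {k : ℕ} (x : V → Fin k → ℝ)
    (π : Equiv.Perm (Fin k)) (d : V → Fin k) :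
    Measurable fun ρ => genColorRound x ρ π d := by
  have key : ∀ (l : List (Fin k)) (Y : ℝ → V → Fin k), Measurable Y →
      Measurable fun ρ =>
        l.foldl (fun Y i v => if x v (π i) < ρ then π i else Y v) (Y ρ) := by
    intro l
    induction l with
    | nil => exact fun Y hY => hY
    | cons a l ih =>
      intro Y hY
      refine ih (fun ρ v => if x v (π a) < ρ then π a else Y ρ v) (measurable_pi_iff.2 fun v => ?_)
      exact Measurable.ite (measurableSet_lt measurable_const measurable_id) measurable_const
        (measurable_pi_iff.1 hY v)
  exact key _ _ measurable_const

namespace EdgeColoredHypergraph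

variable {V E : Type*} {k : ℕ} (H : EdgeColoredHypergraph V E k)

/-- The integral LP solution that a node coloring induces. -/
theorem lpFeasible_of_coloring (Y : V → Fin k) :
    H.LPFeasible (fun v i => if Y v = i then 0 else 1) ((H.mistakes Y).indicator 1) where
  sum_eq v := by
    have h : ∀ i, (if Y v = i then (0 : ℝ) else 1) = 1 - if Y v = i then 1 else 0 := fun i => by
      split_ifs <;> norm_num
    simp [h, Finset.sum_sub_distrib]
  node_le_edge e v hv := by
    by_cases h : Y v = H.color e
    · rw [if_pos h]
      exact Set.indicator_nonneg (fun _ _ => zero_le_one) e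
    · rw [if_neg h, Set.indicator_of_mem (show e ∈ H.mistakes Y from ⟨v, hv, h⟩)]
      exact le_rfl
  node_mem v i := by split_ifs <;> norm_num
  edge_mem e :=
    ⟨Set.indicator_nonneg (fun _ _ => zero_le_one) e,
      Set.indicator_le_self' (fun _ _ => zero_le_one) e⟩

theorem isCompact_setOf_lpFeasible :
    IsCompact {q : (V → Fin k → ℝ) × (E → ℝ) | H.LPFeasible q.1 q.2} := by
  have hsub : {q : (V → Fin k → ℝ) × (E → ℝ) | H.LPFeasible q.1 q.2} =
      (Set.Icc 0 1) ∩ ((⋂ v, {q | ∑ i, q.1 v i = (k : ℝ) - 1}) ∩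
        ⋂ e, ⋂ v, ⋂ _ : v ∈ H.nodes e, {q | q.1 v (H.color e) ≤ q.2 e}) := by
    ext q
    simp only [Set.mem_inter_iff, Set.mem_iInter, Set.mem_ofPred_eq, Set.mem_Icc, Prod.le_def,
      Pi.le_def]
    constructor
    · exact fun h => ⟨⟨⟨fun v i => (h.node_mem v i).1, fun e => (h.edge_mem e).1⟩,
        fun v i => (h.node_mem v i).2, fun e => (h.edge_mem e).2⟩, h.sum_eq, h.node_le_edge⟩
    · exact fun h => ⟨h.2.1, h.2.2, fun v i => ⟨h.1.1.1 v i, h.1.2.1 v i⟩,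
        fun e => ⟨h.1.1.2 e, h.1.2.2 e⟩⟩
  rw [hsub]
  have hIcc : (Set.Icc 0 1 : Set ((V → Fin k → ℝ) × (E → ℝ))) =
      (Set.univ.pi fun _ => Set.univ.pi fun _ => Set.Icc 0 1) ×ˢ
        (Set.univ.pi fun _ => Set.Icc 0 1) := by
    ext q
    simp only [Set.mem_Icc, Prod.le_def, Pi.le_def, Set.mem_prod, Set.mem_univ_pi]
    exact ⟨fun h => ⟨fun v i => ⟨h.1.1 v i, h.2.1 v i⟩, fun e => ⟨h.1.2 e, h.2.2 e⟩⟩,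
      fun h => ⟨⟨fun v i => (h.1 v i).1, fun e => (h.2 e).1⟩,
        fun v i => (h.1 v i).2, fun e => (h.2 e).2⟩⟩
  rw [hIcc]
  refine ((isCompact_univ_pi fun _ => isCompact_univ_pi fun _ => isCompact_Icc).prod
    (isCompact_univ_pi fun _ => isCompact_Icc)).inter_right (IsClosed.inter ?_ ?_)
  · exact isClosed_iInter fun v => isClosed_eq (by fun_prop) continuous_const
  · exact isClosed_iInter fun e => isClosed_iInter fun v => isClosed_iInter fun _ =>
      isClosed_le (by fun_prop) (by fun_prop)

variable [Fintype E]

/-- Permutations and colorings form countable spaces, so measurability in the threshold alone is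
enough. -/
theorem measurable_cost_genColorRound [Finite V] (x : V → Fin k → ℝ) :
    Measurable fun q : (ℝ × Equiv.Perm (Fin k)) × (V → Fin k) =>
      H.cost (genColorRound x q.1.1 q.1.2 q.2) := by
  refine measurable_from_prod_countable_left fun d => ?_
  refine measurable_from_prod_countable_left fun π => ?_
  exact (measurable_of_countable H.cost).comp (measurable_genColorRound_threshold x π d)

theorem cost_nonneg (Y : V → Fin k) : 0 ≤ H.cost Y :=
  Finset.sum_nonneg fun e _ => mul_nonneg (H.weight_nonneg e)
    (Set.indicator_nonneg (fun _ _ => zero_le_one) _)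

theorem cost_le_sum_weight (Y : V → Fin k) : H.cost Y ≤ ∑ e, H.weight e :=
  Finset.sum_le_sum fun e _ => mul_le_of_le_one_right (H.weight_nonneg e)
    (Set.indicator_le_self' (fun _ _ => zero_le_one) e)

variable {H} in
theorem LPOptimal.lpObjective_le_minECC {x : V → Fin k → ℝ} {y : E → ℝ} (h : H.LPOptimal x y)
    (hk : 1 ≤ k) : H.lpObjective y ≤ H.minECC := by
  have : Nonempty (V → Fin k) := ⟨fun _ => ⟨0, hk⟩⟩
  exact le_ciInf fun Y => h.2 _ _ (H.lpFeasible_of_coloring Y)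

theorem exists_lpOptimal (hk : 1 ≤ k) : ∃ x y, H.LPOptimal x y := by
  obtain ⟨q, hq, hmin⟩ := H.isCompact_setOf_lpFeasible.exists_isMinOn
    ⟨(_, _), H.lpFeasible_of_coloring fun _ => ⟨0, hk⟩⟩
    (f := fun q => H.lpObjective q.2)
    (by unfold lpObjective; fun_prop)
  exact ⟨q.1, q.2, hq, fun x' y' h => hmin (show (x', y') ∈ {q | _} from h)⟩

theorem exists_endpoints (hr : H.rank ≤ 2) {e : E} (he : (H.nodes e).Nonempty) :
    ∃ u ∈ H.nodes e, ∃ v ∈ H.nodes e, ∀ w ∈ H.nodes e, w = u ∨ w = v := by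
  classical
  have hcard : (H.nodes e).card ≤ 2 :=
    (Finset.le_sup (f := fun e => (H.nodes e).card) (Finset.mem_univ e)).trans hr
  obtain ⟨u, hu⟩ := he
  rcases ((H.nodes e).erase u).eq_empty_or_nonempty with h | ⟨v, hv⟩
  -- A one-node edge is treated as having two equal endpoints.
  · refine ⟨u, hu, u, hu, fun w hw => Or.inl ?_⟩
    by_contra hne
    exact Finset.notMem_empty w (h ▸ Finset.mem_erase.2 ⟨hne, hw⟩)
  · refine ⟨u, hu, v, Finset.mem_of_mem_erase hv, fun w hw => ?_⟩
    by_contra! hne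
    have h1 : ((H.nodes e).erase u).card ≤ 1 := by
      rw [Finset.card_erase_of_mem hu]; omega
    exact hne.2 (Finset.card_le_one.1 h1 w (Finset.mem_erase.2 ⟨hne.1, hw⟩) v hv)

/-- The random choices that may lead to a mistake at an edge with at most two nodes. -/
theorem exists_mistake_event (hr : H.rank ≤ 2) {x : V → Fin k → ℝ} {y : E → ℝ}
    (h : H.LPFeasible x y) (e : E) :
    ∃ B : Set (ℝ × Equiv.Perm (Fin k)), MeasurableSet B ∧
      (∀ ρ π d, e ∈ H.mistakes (genColorRound x ρ π d) → (ρ, π) ∈ B) ∧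
      (roundingLaw k (Set.Ioo (1 / 2) (7 / 8))).real B ≤ 4 / 3 * y e := by
  rcases (H.nodes e).eq_empty_or_nonempty with he | he
  · refine ⟨∅, MeasurableSet.empty, ?_, ?_⟩
    · rintro ρ π d ⟨v, hv, -⟩
      simp [he] at hv
    · have := (h.edge_mem e).1
      rw [measureReal_empty]; positivity
  · obtain ⟨u, hu, v, hv, huv⟩ := H.exists_endpoints hr he
    refine ⟨unsafeChoices x u v (H.color e), measurableSet_unsafeChoices _ _ _ _,
      fun ρ π d => mem_unsafeChoices_of_mem_mistakes huv, ?_⟩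
    refine (roundingLaw_real_unsafeChoices_le (fun w i => (h.node_mem w i).1)
      (fun w i => (h.node_mem w i).2) h.sum_eq).trans ?_
    have := max_le (h.node_le_edge e u hu) (h.node_le_edge e v hv)
    linarith

end EdgeColoredHypergraph

/-! ### The approximation guarantee -/

theorem mainTheorem1 {V E : Type*} [Fintype V] [Fintype E] {k : ℕ} (hk : 1 ≤ k)
    (H : EdgeColoredHypergraph V E k) (hr : H.rank ≤ 2) :
    (∃ x y, H.LPOptimal x y) ∧
    ∀ (x : V → Fin k → ℝ) (y : E → ℝ), H.LPOptimal x y →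
      ∀ {Ω : Type*} [MeasurableSpace Ω] (P : Measure Ω) [IsProbabilityMeasure P]
        (ρ : Ω → ℝ) (π : Ω → Equiv.Perm (Fin k)) (d : Ω → V → Fin k),
        HasLaw (fun ω => (ρ ω, π ω)) (roundingLaw k (Set.Ioo (1 / 2) (7 / 8))) P →
        Measurable d →
        Integrable (fun ω => H.cost (genColorRound x (ρ ω) (π ω) (d ω))) P ∧
        ∫ ω, H.cost (genColorRound x (ρ ω) (π ω) (d ω)) ∂P ≤ 4 / 3 * H.lpObjective y ∧
        ∫ ω, H.cost (genColorRound x (ρ ω) (π ω) (d ω)) ∂P ≤ 4 / 3 * H.minECC := by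
  refine ⟨H.exists_lpOptimal hk, ?_⟩
  intro x y hopt Ω _ P _ ρ π d hlaw hd
  have hint : Integrable (fun ω => H.cost (genColorRound x (ρ ω) (π ω) (d ω))) P := by
    refine Integrable.of_bound (((H.measurable_cost_genColorRound x).comp_aemeasurable
      (hlaw.aemeasurable.prodMk hd.aemeasurable)).aestronglyMeasurable) (∑ e, H.weight e)
      (.of_forall fun ω => ?_)
    rw [Real.norm_of_nonneg (H.cost_nonneg _)]
    exact H.cost_le_sum_weight _
  have hmain : ∫ ω, H.cost (genColorRound x (ρ ω) (π ω) (d ω)) ∂P ≤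
      4 / 3 * H.lpObjective y := by
    -- The events `B e` involve only the threshold and the permutation, so the law of that pair
    -- suffices, however `d` depends on it.
    choose B hBm hB hBy using H.exists_mistake_event hr hopt.1
    have hBint : ∀ e, Integrable (fun ω =>
        H.weight e * (B e).indicator (1 : ℝ × Equiv.Perm (Fin k) → ℝ) (ρ ω, π ω)) P := fun e =>
      (Integrable.of_bound
        ((measurable_one.indicator (hBm e)).comp_aemeasurable
          hlaw.aemeasurable).aestronglyMeasurable 1 (.of_forall fun ω =>
            (norm_indicator_le_norm_self _ _).trans (by simp))).const_mul _
    have hBval : ∀ e, ∫ ω, (B e).indicator (1 : ℝ × Equiv.Perm (Fin k) → ℝ) (ρ ω, π ω) ∂P ≤ 4 / 3 * y e := fun e => by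
      refine (le_of_eq ?_).trans (hBy e)
      rw [← integral_indicator_one (hBm e)]
      exact hlaw.integral_comp (measurable_one.indicator (hBm e)).aestronglyMeasurable
    calc _ ≤ ∫ ω, ∑ e, H.weight e * (B e).indicator (1 : ℝ × Equiv.Perm (Fin k) → ℝ) (ρ ω, π ω) ∂P := by
          refine integral_mono hint (integrable_finsetSum _ fun e _ => hBint e) fun ω => ?_
          refine Finset.sum_le_sum fun e _ =>
            mul_le_mul_of_nonneg_left ?_ (H.weight_nonneg e)
          by_cases he : e ∈ H.mistakes (genColorRound x (ρ ω) (π ω) (d ω))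
          · rw [Set.indicator_of_mem he, Set.indicator_of_mem (hB e _ _ _ he)]; simp
          · rw [Set.indicator_of_notMem he]
            exact Set.indicator_nonneg (fun _ _ => zero_le_one) _
      _ = ∑ e, H.weight e * ∫ ω, (B e).indicator (1 : ℝ × Equiv.Perm (Fin k) → ℝ) (ρ ω, π ω) ∂P := by
          rw [integral_finsetSum _ fun e _ => hBint e]
          exact Finset.sum_congr rfl fun e _ => integral_const_mul _ _
      _ ≤ ∑ e, H.weight e * (4 / 3 * y e) :=
          Finset.sum_le_sum fun e _ => mul_le_mul_of_nonneg_left (hBval e) (H.weight_nonneg e)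
      _ = 4 / 3 * H.lpObjective y := by
          rw [EdgeColoredHypergraph.lpObjective, Finset.mul_sum]
          exact Finset.sum_congr rfl fun e _ => by ring
  refine ⟨hint, hmain, hmain.trans ?_⟩
  have := hopt.lpObjective_le_minECC hk
  linarith
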